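/- All locally convex spaces are Hausdorff and over $\mathbb{C}$; $E'$ is the topological dual of $E$, and $E'_\sigma$ is $E'$ with the weak$^*$ topology. A locally convex space $E$ is *$B$-complete* if a linear subspace $X\subseteq E'$ is closed in $E'_\sigma$ if and only if $X\cap A$ is closed in $A$ (with the relative topology of $E'_\sigma$) for every equicontinuous set $A\subset E'$. A sequence of continuous linear maps $T_n:E\to F_n$, $n\in\mathbb{N}$, between locally convex spaces is *Eidelheit* if for every $(y_n)_n\in\prod_n F_n$ there is $x\in E$ with $T_n(x)=y_n$ for all $n\in\mathbb{N}$; a sequence $(x'_n)_n\subset E'$ is Eidelheit if it is so as a sequence of maps $E\to\mathbb{C}$. A subset of $F$ is *total* if its linear span is dense in $F$. On $E\otimes F$, the $\varepsilon$-topology is the topology of uniform convergence on the products of equicontinuous subsets of $E'$ and $F'$, where $E\otimes F$ is regarded as a space of bilinear functionals on $E'\times F'$ via $(x\otimes y)(x',y')=\langle x',x\rangle\langle y',y\rangle$. The $\pi$-topology (resp. $\beta$-topology) is the finest locally convex topology on $E\otimes F$ for which the canonical bilinear map $E\times F\to E\otimes F$ is jointly continuous (resp. hypocontinuous with respect to the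 bounded sets of both factors). For $t\in\{\varepsilon,\pi,\beta\}$, $E\widehat\otimes_t F$ is the completion of $E\otimes F$ endowed with the $t$-topology. If $F$ is complete, the *$F$-associated sequence* (with respect to the $t$-topology) of $(x'_n)_n\subset E'$ consists of the continuous linear maps $x'_n\widehat\otimes_t\mathrm{Id}_F:E\widehat\otimes_t F\to F$ that extend $x\otimes y\mapsto\langle x'_n,x\rangle\,y$. **Proposition.** Let $E$ and $F$ be locally convex spaces. (i) Let $t=\varepsilon$ or $t=\pi$. If $E$ is $B$-complete, $F$ is barreled and complete, and $E\widehat\otimes_t F$ is $B$-complete, then for every Eidelheit sequence $(x'_n)_n\subset E'$ its $F$-associated sequence with respect to the $t$-topology is Eidelheit. (ii) If $E$ is $B$-complete, $F$ is barreled and complete and contains a bounded total set, and $E\widehat\otimes_\beta F$ is $B$-complete, then for every Eidelheit sequence $(x'_n)_n\subset E'$ its $F$-associated sequence with respect to the $\beta$-topology is Eidelheit. -/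

import Mathlib

open scoped TensorProduct Topology UniformConvergence

noncomputable section

/-- A set `A` of continuous linear functionals on `E` (seen in `E'` or in `E'_σ`) is
equicontinuous. -/
def IsEquicontinuousSet {E D : Type*} [TopologicalSpace E] [FunLike D E ℂ] (A : Set D) : Prop :=
  Equicontinuous (fun (f : A) (x : E) => (f : D) x)

/-- `B`-completeness (Pták spaces). `WeakDual ℂ E` is the dual `E'` with the weak-star topology,
and `(↑) ⁻¹' X : Set A` is the trace `X ∩ A` in the subspace `A` of `E'_σ`. -/
def BComplete (E : Type*) [AddCommGroup E] [Module ℂ E] [TopologicalSpace E] : Prop :=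
  ∀ X : Submodule ℂ (WeakDual ℂ E),
    IsClosed (X : Set (WeakDual ℂ E)) ↔
      ∀ A : Set (WeakDual ℂ E), IsEquicontinuousSet (E := E) A →
        IsClosed ((fun a : A => (a : WeakDual ℂ E)) ⁻¹' (X : Set (WeakDual ℂ E)))

/-- `(T n)` is an Eidelheit sequence: the system `T n x = y n`, `n ∈ ℕ`, has a solution `x`
for every choice of the right-hand sides. -/
def IsEidelheit {E : Type*} {G : ℕ → Type*} [AddCommGroup E] [Module ℂ E] [TopologicalSpace E]
    [∀ n, AddCommGroup (G n)] [∀ n, Module ℂ (G n)] [∀ n, TopologicalSpace (G n)]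
    (T : ∀ n, E →L[ℂ] G n) : Prop :=
  ∀ y : ∀ n, G n, ∃ x : E, ∀ n, T n x = y n

/-- A subset of `F` is total if its linear span is dense. -/
def IsTotalSet {F : Type*} [AddCommGroup F] [Module ℂ F] [TopologicalSpace F] (B : Set F) : Prop :=
  Dense (Submodule.span ℂ B : Set F)

/-- The finest locally convex vector space topology `τ` on `V` with the property `P τ`. In
Mathlib's order the finer topology is the smaller one. -/
abbrev finestLocallyConvex {V : Type*} [AddCommGroup V] [Module ℂ V]
    (P : TopologicalSpace V → Prop) : TopologicalSpace V :=
  sInf {τ | @IsTopologicalAddGroup V τ _ ∧ @ContinuousSMul ℂ V _ _ τ ∧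
    @LocallyConvexSpace ℝ V _ _ _ _ τ ∧ P τ}

section TensorTopologies

variable {E F : Type*} [AddCommGroup E] [Module ℂ E] [TopologicalSpace E]
  [AddCommGroup F] [Module ℂ F] [TopologicalSpace F]

/-- Hypocontinuity of a bilinear map, with respect to the bounded sets of both factors. -/
def IsHypocontinuous {V : Type*} [AddCommGroup V] [Module ℂ V] [TopologicalSpace V]
    (b : E →ₗ[ℂ] F →ₗ[ℂ] V) : Prop :=
  (∀ B : Set F, Bornology.IsVonNBounded ℂ B → ∀ W ∈ 𝓝 (0 : V), ∃ U ∈ 𝓝 (0 : E),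
    ∀ x ∈ U, ∀ y ∈ B, b x y ∈ W) ∧
  (∀ A : Set E, Bornology.IsVonNBounded ℂ A → ∀ W ∈ 𝓝 (0 : V), ∃ U ∈ 𝓝 (0 : F),
    ∀ x ∈ A, ∀ y ∈ U, b x y ∈ W)

variable (E F)

/-- `z ∈ E ⊗ F` as the bilinear functional `(x', y') ↦ (x' ⊗ y') z` on `E' × F'`, for which
`(x ⊗ y) (x', y') = x' x * y' y`. -/
def tensorToBilin : (E ⊗[ℂ] F) →ₗ[ℂ] (StrongDual ℂ E × StrongDual ℂ F → ℂ) :=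
  LinearMap.pi fun p =>
    TensorProduct.dualDistrib ℂ E F ((p.1 : E →ₗ[ℂ] ℂ) ⊗ₜ[ℂ] (p.2 : F →ₗ[ℂ] ℂ))

/-- The products of equicontinuous subsets of `E'` and `F'`. -/
def equicontinuousProducts : Set (Set (StrongDual ℂ E × StrongDual ℂ F)) :=
  {S | ∃ (A : Set (StrongDual ℂ E)) (B : Set (StrongDual ℂ F)),
    IsEquicontinuousSet (E := E) A ∧ IsEquicontinuousSet (E := F) B ∧ S = A ×ˢ B}

/-- The `ε`-topology: uniform convergence on the products of equicontinuous subsets of `E'`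
and `F'`. -/
abbrev epsilonTopology : TopologicalSpace (E ⊗[ℂ] F) :=
  TopologicalSpace.induced
    (fun z => UniformOnFun.ofFun (equicontinuousProducts E F) (tensorToBilin E F z)) inferInstance

/-- The `π`-topology: the finest locally convex topology on `E ⊗ F` for which the canonical
bilinear map `E × F → E ⊗ F` is jointly continuous. -/
abbrev piTopology : TopologicalSpace (E ⊗[ℂ] F) :=
  finestLocallyConvex fun τ =>
    @Continuous (E × F) (E ⊗[ℂ] F) _ τ fun p => p.1 ⊗ₜ[ℂ] p.2

/-- The `β`-topology: the finest locally convex topology on `E ⊗ F` for which the canonical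
bilinear map `E × F → E ⊗ F` is hypocontinuous. -/
abbrev betaTopology : TopologicalSpace (E ⊗[ℂ] F) :=
  finestLocallyConvex fun τ =>
    @IsHypocontinuous E F _ _ _ _ _ _ (E ⊗[ℂ] F) _ _ τ (TensorProduct.mk ℂ E F)

end TensorTopologies

/-- Names of the three tensor product topologies. -/
inductive TensorTop
  /-- the `ε`-topology -/
  | epsilon
  /-- the `π`-topology -/
  | pi
  /-- the `β`-topology -/
  | beta

/-- `E ⊗_t F`: the algebraic tensor product, to be endowed with the `t`-topology. -/
def TopTensor (_t : TensorTop) (E F : Type*) [AddCommGroup E] [Module ℂ E] [AddCommGroup F]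
    [Module ℂ F] : Type _ :=
  E ⊗[ℂ] F

section TopTensor

variable (t : TensorTop) (E F : Type*)

instance [AddCommGroup E] [Module ℂ E] [AddCommGroup F] [Module ℂ F] :
    AddCommGroup (TopTensor t E F) :=
  inferInstanceAs (AddCommGroup (E ⊗[ℂ] F))

instance [AddCommGroup E] [Module ℂ E] [AddCommGroup F] [Module ℂ F] :
    Module ℂ (TopTensor t E F) :=
  inferInstanceAs (Module ℂ (E ⊗[ℂ] F))

variable [AddCommGroup E] [Module ℂ E] [TopologicalSpace E]
  [AddCommGroup F] [Module ℂ F] [TopologicalSpace F]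

/-- The `t`-topology on `E ⊗ F`. -/
abbrev tensorTopology : TensorTop → TopologicalSpace (E ⊗[ℂ] F)
  | .epsilon => epsilonTopology E F
  | .pi => piTopology E F
  | .beta => betaTopology E F

instance : TopologicalSpace (TopTensor t E F) := tensorTopology E F t

theorem finestLocallyConvex_isTopologicalAddGroup {V : Type*} [AddCommGroup V] [Module ℂ V]
    (P : TopologicalSpace V → Prop) : @IsTopologicalAddGroup V (finestLocallyConvex P) _ :=
  topologicalAddGroup_sInf fun _ h => h.1

theorem finestLocallyConvex_continuousSMul {V : Type*} [AddCommGroup V] [Module ℂ V]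
    (P : TopologicalSpace V → Prop) : @ContinuousSMul ℂ V _ _ (finestLocallyConvex P) :=
  continuousSMul_sInf fun _ h => h.2.1

/-- The `ε`-topology is induced by an additive map into a topological group. -/
theorem epsilonTopology_isTopologicalAddGroup :
    @IsTopologicalAddGroup (E ⊗[ℂ] F) (epsilonTopology E F) _ :=
  topologicalAddGroup_induced
    (AddMonoidHom.mk' (fun z : E ⊗[ℂ] F =>
      UniformOnFun.ofFun (equicontinuousProducts E F) (tensorToBilin E F z))
      fun a b => by rw [map_add]; rfl)

theorem IsEquicontinuousSet.exists_bound {E : Type*} [AddCommGroup E] [Module ℂ E]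
    [TopologicalSpace E] [ContinuousSMul ℂ E]
    {A : Set (StrongDual ℂ E)} (hA : IsEquicontinuousSet (E := E) A) (x : E) :
    ∃ C : ℝ, 0 ≤ C ∧ ∀ f ∈ A, ‖f x‖ ≤ C := by
  have h0 : ∀ᶠ y in 𝓝 (0 : E), ∀ f : A, dist ((f : StrongDual ℂ E) 0)
      ((f : StrongDual ℂ E) y) < 1 :=
    Metric.equicontinuousAt_iff_right.1 (hA 0) 1 one_pos
  have h1 : Filter.Tendsto (fun c : ℂ => c • x) (𝓝[≠] 0) (𝓝 (0 : E)) := by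
    have : Continuous fun c : ℂ => c • x := by fun_prop
    have h := this.tendsto 0
    rw [zero_smul] at h
    exact h.mono_left nhdsWithin_le_nhds
  obtain ⟨c, hc, hc0⟩ := ((h1.eventually h0).and self_mem_nhdsWithin).exists
  have hc0 : c ≠ 0 := hc0
  refine ⟨‖c‖⁻¹, by positivity, fun f hf => ?_⟩
  have := hc ⟨f, hf⟩
  simp only [map_zero, map_smul, smul_eq_mul, dist_zero_left, norm_mul] at this
  rw [← one_div, le_div_iff₀ (norm_pos_iff.2 hc0), mul_comm]
  exact this.le

theorem epsilonTopology_continuousSMul [ContinuousSMul ℂ E] [ContinuousSMul ℂ F] :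
    @ContinuousSMul ℂ (E ⊗[ℂ] F) _ _ (epsilonTopology E F) := by
  let := epsilonTopology E F
  refine UniformOnFun.continuousSMul_induced_of_image_bounded ℂ _ ℂ (E ⊗[ℂ] F)
    (tensorToBilin E F) (𝔖 := equicontinuousProducts E F) ⟨rfl⟩ ?_
  rintro z S ⟨A, B, hA, hB, rfl⟩
  rw [NormedSpace.isVonNBounded_iff, isBounded_iff_forall_norm_le]
  suffices h : ∃ C : ℝ, ∀ p ∈ A ×ˢ B, ‖tensorToBilin E F z p‖ ≤ C by
    obtain ⟨C, hC⟩ := h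
    exact ⟨C, by rintro _ ⟨p, hp, rfl⟩; exact hC p hp⟩
  induction z with
  | zero => exact ⟨0, fun p _ => by simp⟩
  | tmul x y =>
    obtain ⟨C, hC0, hC⟩ := hA.exists_bound x
    obtain ⟨D, hD0, hD⟩ := hB.exists_bound y
    refine ⟨C * D, fun p hp => ?_⟩
    simp only [tensorToBilin, LinearMap.pi_apply, TensorProduct.dualDistrib_apply, norm_mul]
    exact mul_le_mul (hC _ hp.1) (hD _ hp.2) (norm_nonneg _) hC0
  | add a b ha hb =>
    obtain ⟨C, hC⟩ := ha
    obtain ⟨D, hD⟩ := hb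
    refine ⟨C + D, fun p hp => ?_⟩
    rw [map_add]
    exact (norm_add_le _ _).trans (add_le_add (hC p hp) (hD p hp))

instance : IsTopologicalAddGroup (TopTensor t E F) := by
  cases t
  · exact epsilonTopology_isTopologicalAddGroup E F
  · exact finestLocallyConvex_isTopologicalAddGroup _
  · exact finestLocallyConvex_isTopologicalAddGroup _

instance [ContinuousSMul ℂ E] [ContinuousSMul ℂ F] : ContinuousSMul ℂ (TopTensor t E F) := by
  cases t
  · exact epsilonTopology_continuousSMul E F
  · exact finestLocallyConvex_continuousSMul _
  · exact finestLocallyConvex_continuousSMul _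

/-- The uniform structure of the topological group `E ⊗_t F`. -/
instance : UniformSpace (TopTensor t E F) := IsTopologicalAddGroup.rightUniformSpace _

instance : IsUniformAddGroup (TopTensor t E F) := isUniformAddGroup_of_addCommGroup

instance [ContinuousSMul ℂ E] [ContinuousSMul ℂ F] :
    UniformContinuousConstSMul ℂ (TopTensor t E F) :=
  uniformContinuousConstSMul_of_continuousConstSMul _ _

/-- `E ⊗̂_t F`: the completion of `E ⊗_t F`. -/
abbrev CompletedTensor : Type _ := UniformSpace.Completion (TopTensor t E F)

end TopTensor

section Associated

variable {E F : Type*} [AddCommGroup E] [Module ℂ E] [TopologicalSpace E]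
  [AddCommGroup F] [Module ℂ F]

/-- `x' ⊗ Id_F : E ⊗ F → F` (with `ℂ ⊗ F = F`), that is, `x ⊗ y ↦ x' x • y`. -/
def tensorIdLin (x' : StrongDual ℂ E) : (E ⊗[ℂ] F) →ₗ[ℂ] F :=
  (TensorProduct.lid ℂ F).toLinearMap ∘ₗ LinearMap.rTensor F (x' : E →ₗ[ℂ] ℂ)

theorem tensorIdLin_tmul (x' : StrongDual ℂ E) (x : E) (y : F) :
    tensorIdLin x' (x ⊗ₜ[ℂ] y) = x' x • y := by
  simp [tensorIdLin]

theorem apply_tensorIdLin [TopologicalSpace F] (x' : StrongDual ℂ E) (f : StrongDual ℂ F) (z : E ⊗[ℂ] F) :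
    f (tensorIdLin x' z) = tensorToBilin E F z (x', f) := by
  induction z with
  | zero => simp
  | tmul x y => simp [tensorIdLin_tmul, tensorToBilin]
  | add a b ha hb => simp only [map_add, ha, hb, Pi.add_apply]

variable [TopologicalSpace F] [IsTopologicalAddGroup F] [ContinuousSMul ℂ F]
  [LocallyConvexSpace ℝ F]

/-- A linear map into a locally convex space is continuous for the finest locally convex
topology with the property `P` as soon as the topology it induces has the property `P`. -/
theorem continuous_finestLocallyConvex {V : Type*} [AddCommGroup V] [Module ℂ V]
    (P : TopologicalSpace V → Prop) (f : V →ₗ[ℂ] F)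
    (h : P (TopologicalSpace.induced f inferInstance)) :
    @Continuous V F (finestLocallyConvex P) _ f := by
  rw [continuous_iff_le_induced]
  refine sInf_le ⟨topologicalAddGroup_induced f, continuousSMul_induced f, ?_, h⟩
  exact LocallyConvexSpace.induced (f.restrictScalars ℝ)

/-- A locally convex space has a topology given by `ℂ`-seminorms. -/
theorem polynormable_of_locallyConvex : PolynormableSpace ℂ F := by
  have h : @LocallyConvexSpace ℂ F _ RCLike.toPartialOrder _ _ _ := by
    let : PartialOrder ℂ := RCLike.toPartialOrder
    rw [locallyConvexSpace_iff]
    intro x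
    refine (LocallyConvexSpace.convex_basis (𝕜 := ℝ) x).to_hasBasis (fun s hs => ?_)
      (fun s hs => ⟨s, ⟨hs.1, ?_⟩, subset_rfl⟩)
    · refine ⟨s, ⟨hs.1, ?_⟩, subset_rfl⟩
      intro u hu v hv a b ha hb hab
      obtain ⟨c, hc, rfl⟩ := RCLike.nonneg_iff_exists_ofReal.1 ha
      obtain ⟨d, hd, rfl⟩ := RCLike.nonneg_iff_exists_ofReal.1 hb
      have := hs.2 hu hv hc hd (by simpa using congrArg Complex.re hab)
      simpa [Complex.coe_smul] using this
    · intro u hu v hv a b ha hb hab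
      have := hs.2 hu hv (RCLike.ofReal_nonneg (K := ℂ).2 ha)
        (RCLike.ofReal_nonneg (K := ℂ).2 hb) (by
          rw [← RCLike.ofReal_add, hab, RCLike.ofReal_one])
      simpa [Complex.coe_smul] using this
  have : ContinuousSMul ℝ F := IsScalarTower.continuousSMul ℂ
  exact @LocallyConvexSpace.toPolynormableSpace ℂ F _ _ _ _ _ _ _ _ _ h

/-- For a continuous seminorm `p` on a locally convex space, `p y` is attained by a continuous
functional bounded by `p` (Hahn-Banach). -/
theorem exists_functional_eq_seminorm {p : Seminorm ℂ F} (hp : Continuous p) (y : F) :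
    ∃ f : StrongDual ℂ F, ‖f y‖ = p y ∧ ∀ v, ‖f v‖ ≤ p v := by
  have : PolynormableSpace ℂ F := polynormable_of_locallyConvex
  by_cases hy : y = 0
  · exact ⟨0, by simp [hy], fun v => by simp⟩
  · let e := LinearEquiv.toSpanNonzeroSingleton ℂ F y hy
    let g : Module.Dual ℂ (Submodule.span ℂ {y}) := ((p y : ℝ) : ℂ) • e.symm.toLinearMap
    have hpos : 0 ≤ p y := apply_nonneg p y
    have hg : ∀ x, ‖g x‖ ≤ p x := by
      intro x
      obtain ⟨c, rfl⟩ := e.surjective x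
      have h1 : g (e c) = (p y : ℂ) * c := by simp [g]
      have h2 : ((e c : Submodule.span ℂ {y}) : F) = c • y := rfl
      rw [h1, h2, map_smul_eq_mul, norm_mul, Complex.norm_real, Real.norm_of_nonneg hpos, mul_comm]
    obtain ⟨f, hf, hle⟩ :=
      Module.Dual.exists_continuous_extension_of_le_seminorm (Submodule.span ℂ {y}) g hp hg
    refine ⟨f, ?_, hle⟩
    have h1 : f y = g (e 1) := by
      rw [← hf]
      simp [e]
    rw [h1]
    simp [g, abs_of_nonneg hpos]

theorem continuous_tensorIdLin_epsilon (x' : StrongDual ℂ E) :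
    @Continuous (E ⊗[ℂ] F) F (epsilonTopology E F) _ (tensorIdLin x') := by
  have : PolynormableSpace ℂ F := polynormable_of_locallyConvex
  let := epsilonTopology E F
  have := epsilonTopology_isTopologicalAddGroup E F
  refine continuous_of_continuousAt_zero (tensorIdLin x' : (E ⊗[ℂ] F) →ₗ[ℂ] F) ?_
  rw [ContinuousAt, map_zero, (PolynormableSpace.withSeminorms ℂ F).tendsto_nhds]
  rintro ⟨p, hp⟩ r hr
  have hS : ({x'} ×ˢ {f : StrongDual ℂ F | ∀ v, ‖f v‖ ≤ p v}) ∈ equicontinuousProducts E F := by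
    refine ⟨_, _, ?_, ?_, rfl⟩
    · intro x
      rw [Metric.equicontinuousAt_iff_right]
      intro δ hδ
      have := x'.continuous.tendsto x (Metric.ball_mem_nhds _ hδ)
      filter_upwards [this] with y hy
      rintro ⟨f, rfl⟩
      rw [dist_comm]
      exact hy
    · intro x
      rw [Metric.equicontinuousAt_iff_right]
      intro δ hδ
      have hc : Continuous fun y => p (x - y) := hp.comp (by fun_prop)
      have := hc.tendsto x
      simp only [sub_self, map_zero] at this
      filter_upwards [this.eventually (gt_mem_nhds hδ)] with y hy
      rintro ⟨f, hf⟩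
      rw [dist_eq_norm]
      change ‖f x - f y‖ < δ
      rw [← map_sub]
      exact (hf _).trans_lt hy
  have hcont : Continuous fun z : E ⊗[ℂ] F =>
      UniformOnFun.ofFun (equicontinuousProducts E F) (tensorToBilin E F z) :=
    continuous_induced_dom
  have h0 := UniformOnFun.tendsto_iff_tendstoUniformlyOn.1 (hcont.tendsto 0) _ hS
  have h1 := Metric.tendstoUniformlyOn_iff.1 h0 r hr
  filter_upwards [h1] with z hz
  obtain ⟨f, hf, hle⟩ := exists_functional_eq_seminorm hp (tensorIdLin x' z)
  have := hz (x', f) ⟨rfl, hle⟩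
  rw [sub_zero]
  change p (tensorIdLin x' z) < r
  rw [← hf, apply_tensorIdLin]
  simpa using this

theorem continuous_tensorIdLin (t : TensorTop) [ContinuousSMul ℂ E] (x' : StrongDual ℂ E) :
    @Continuous (TopTensor t E F) F _ _ (tensorIdLin x') := by
  cases t
  · exact continuous_tensorIdLin_epsilon x'
  · refine continuous_finestLocallyConvex _ (tensorIdLin x') ?_
    rw [continuous_induced_rng]
    have : (⇑(tensorIdLin x') ∘ fun p : E × F => p.1 ⊗ₜ[ℂ] p.2) = fun p => x' p.1 • p.2 := by
      ext p; simp [tensorIdLin_tmul]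
    rw [this]
    fun_prop
  · refine continuous_finestLocallyConvex _ (tensorIdLin x') ⟨?_, ?_⟩
    · intro B hB W hW
      rw [nhds_induced, map_zero] at hW
      obtain ⟨V, hV, hVW⟩ := hW
      have h1 : Filter.Tendsto x' (𝓝 0) (𝓝 0) := by
        simpa using x'.continuous.tendsto 0
      have h2 := h1.eventually ((hB hV).eventually_nhds_zero (mem_of_mem_nhds hV))
      refine ⟨_, h2, fun x hx y hy => hVW ?_⟩
      rw [Set.mem_preimage, TensorProduct.mk_apply, tensorIdLin_tmul]
      exact hx hy
    · intro A hA W hW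
      rw [nhds_induced, map_zero] at hW
      obtain ⟨V, hV, hVW⟩ := hW
      have hb : Bornology.IsVonNBounded ℂ (x' '' A) := hA.image x'
      rw [NormedSpace.isVonNBounded_iff, isBounded_iff_forall_norm_le] at hb
      obtain ⟨C, hC⟩ := hb
      have h1 : Filter.Tendsto (fun y : F => ((max C 1 : ℝ) : ℂ) • y) (𝓝 0) (𝓝 0) := by
        have : Continuous fun y : F => ((max C 1 : ℝ) : ℂ) • y := by fun_prop
        simpa using this.tendsto 0
      refine ⟨_, h1 (balancedCore_mem_nhds_zero (𝕜 := ℂ) hV), fun x hx y hy => hVW ?_⟩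
      rw [Set.mem_preimage, TensorProduct.mk_apply, tensorIdLin_tmul]
      have hpos : (0 : ℝ) < max C 1 := lt_max_of_lt_right one_pos
      have hne : ((max C 1 : ℝ) : ℂ) ≠ 0 := by exact_mod_cast hpos.ne'
      have h2 : x' x • y = (x' x / ((max C 1 : ℝ) : ℂ)) • (((max C 1 : ℝ) : ℂ) • y) := by
        rw [smul_smul, div_mul_cancel₀ _ hne]
      rw [h2]
      refine balancedCore_subset (𝕜 := ℂ) V ((balancedCore_balanced V).smul_mem ?_ hy)
      rw [norm_div, Complex.norm_real, Real.norm_of_nonneg hpos.le, div_le_one hpos]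
      exact (hC _ ⟨x, hx, rfl⟩).trans (le_max_left _ _)

/-- `x' ⊗ Id_F` as a continuous linear map `E ⊗_t F → F`. -/
def tensorId (t : TensorTop) [ContinuousSMul ℂ E] (x' : StrongDual ℂ E) :
    TopTensor t E F →L[ℂ] F where
  toLinearMap := (tensorIdLin x' : (E ⊗[ℂ] F) →ₗ[ℂ] F)
  cont := continuous_tensorIdLin t x'

end Associated

/-- The `F`-associated sequence `x'_n ⊗̂_t Id_F : E ⊗̂_t F → F` of `(x'_n)`: the continuous linear
extensions to the completion of the maps `x'_n ⊗ Id_F`, for complete `F`. -/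
def associatedSequence (t : TensorTop) {E F : Type*}
    [AddCommGroup E] [Module ℂ E] [TopologicalSpace E] [ContinuousSMul ℂ E]
    [AddCommGroup F] [Module ℂ F] [UniformSpace F] [IsUniformAddGroup F] [ContinuousSMul ℂ F]
    [LocallyConvexSpace ℝ F] [T2Space F] [CompleteSpace F]
    (x' : ℕ → StrongDual ℂ E) (n : ℕ) : CompletedTensor t E F →L[ℂ] F :=
  haveI := uniformContinuousConstSMul_of_continuousConstSMul ℂ F
  (tensorId t (x' n)).fromCompletion

end

/-! Bundle the associated maps into one continuous linear map `S` from the completed tensor product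
to `F^ℕ`; the claim is that `S` is onto. Solving the scalar system for unit sequences gives `e n`
biorthogonal to the `x' n`, and `S (e n ⊗ y)` is `y` in coordinate `n`, so all finitely supported
sequences are attained and the range is dense.

By Pták's theorem (`BComplete.surjective`) it remains to show that, for each neighbourhood `U` of
zero, the functionals `g` with `g ∘ S` bounded by 1 on `U` are equicontinuous. Choose a
neighbourhood `V` in `E` and a total set `B` in `F` with `x ⊗ y ∈ U` for `x ∈ V`, `y ∈ B`. For fixed
`y ∈ B`, `c ↦ g (c y)` is a functional on `ℂ^ℕ` whose pullback is bounded by 1 on `V`.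
Banach-Steinhaus on `ℂ^ℕ` makes all of these vanish beyond one index `N` depending only on `V`
(`IsEidelheit.exists_forall_apply_single_eq_zero`); totality of `B` extends this to every `y`. On
the remaining finitely many coordinates, barrelledness of `F` gives equicontinuity
(`exists_nhds_bound_of_pi`).

The tensor topology matters only through `V` and `B`: joint continuity lets `B` be a neighbourhood
of zero, hypocontinuity requires it to be bounded. -/

theorem exists_ne_zero_smul_mem {E : Type*} [AddCommGroup E] [Module ℂ E] [TopologicalSpace E]
    [ContinuousSMul ℂ E] {U : Set E} (hU : U ∈ 𝓝 (0 : E)) (x : E) :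
    ∃ c : ℂ, c ≠ 0 ∧ c • x ∈ U := by
  have h1 : Filter.Tendsto (fun c : ℂ => c • x) (𝓝[≠] 0) (𝓝 (0 : E)) := by
    have : Continuous fun c : ℂ => c • x := by fun_prop
    have h := this.tendsto 0
    rw [zero_smul] at h
    exact h.mono_left nhdsWithin_le_nhds
  obtain ⟨c, hc, hc0⟩ := ((h1.eventually hU).and self_mem_nhdsWithin).exists
  exact ⟨c, hc0, hc⟩

/-! ### Weak-star compactness and separation -/

/-- The **Banach-Alaoglu theorem** for topological vector spaces: the polar of a neighbourhood of
the origin is weak-star compact. -/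
theorem isCompact_weakDual_polar {G : Type*} [AddCommGroup G] [Module ℂ G] [TopologicalSpace G]
    [IsTopologicalAddGroup G] [ContinuousSMul ℂ G] {W : Set G} (hW : W ∈ 𝓝 (0 : G)) :
    IsCompact {g : WeakDual ℂ G | ∀ w ∈ W, ‖g w‖ ≤ 1} := by
  have hemb : Topology.IsEmbedding ((↑) : WeakDual ℂ G → G → ℂ) :=
    DFunLike.coe_injective.isEmbedding_induced
  rw [hemb.isCompact_iff]
  -- A linear form bounded on a neighbourhood of zero is automatically continuous, so the polar is
  -- cut out of `ℂ^G` by pointwise closed conditions.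
  have himg : (fun g : WeakDual ℂ G => (g : G → ℂ)) '' {g | ∀ w ∈ W, ‖g w‖ ≤ 1} =
      Set.range ((↑) : (G →ₗ[ℂ] ℂ) → G → ℂ) ∩ {f | ∀ w ∈ W, ‖f w‖ ≤ 1} := by
    ext f
    constructor
    · rintro ⟨g, hg, rfl⟩
      exact ⟨⟨(WeakDual.toStrongDual g : G →ₗ[ℂ] ℂ), rfl⟩, hg⟩
    · rintro ⟨⟨l, rfl⟩, hl⟩
      refine ⟨StrongDual.toWeakDual (l.clmOfExistsBoundedImage ⟨W, hW, ?_⟩), hl, rfl⟩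
      rw [NormedSpace.isVonNBounded_iff, isBounded_iff_forall_norm_le]
      exact ⟨1, by rintro _ ⟨w, hw, rfl⟩; exact hl w hw⟩
  rw [himg]
  have hbd : ∀ x : G, ∃ C : ℝ, ∀ l : G →ₗ[ℂ] ℂ, (∀ w ∈ W, ‖l w‖ ≤ 1) → ‖l x‖ ≤ C := by
    intro x
    obtain ⟨c, hc, hcx⟩ := exists_ne_zero_smul_mem hW x
    refine ⟨‖c‖⁻¹, fun l hl => ?_⟩
    have := hl _ hcx
    rw [map_smul, smul_eq_mul, norm_mul] at this
    rwa [← one_div, le_div_iff₀ (norm_pos_iff.2 hc), mul_comm]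
  choose C hC using hbd
  refine (isCompact_univ_pi fun x => isCompact_closedBall (0 : ℂ) (C x)).of_isClosed_subset ?_ ?_
  · refine (LinearMap.isClosed_range_coe G ℂ (RingHom.id ℂ)).inter ?_
    simp only [Set.ofPred_forall]
    exact isClosed_biInter fun w _ => isClosed_le (continuous_apply w).norm continuous_const
  · rintro _ ⟨⟨l, rfl⟩, hl⟩ x -
    simpa using hC x l hl

/-- A point outside a closed subspace of a locally convex space is separated from it by a
continuous functional. -/
theorem exists_strongDual_eq_one_of_notMem {V : Type*} [AddCommGroup V] [Module ℂ V]
    [TopologicalSpace V] [IsTopologicalAddGroup V] [ContinuousSMul ℂ V] [LocallyConvexSpace ℝ V]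
    {X : Submodule ℂ V} (hX : IsClosed (X : Set V)) {v : V} (hv : v ∉ X) :
    ∃ f : StrongDual ℂ V, (∀ h ∈ X, f h = 0) ∧ f v = 1 := by
  obtain ⟨f, u, hfu, huf⟩ := RCLike.geometric_hahn_banach_closed_point (𝕜 := ℂ)
    (X.restrictScalars ℝ).convex hX hv
  have hzero : ∀ h ∈ X, f h = 0 := by
    intro h hh
    by_contra hne
    -- The multiple of `h` at which `f` takes the value `u`, contradicting the strict bound on `X`.
    have := hfu _ (X.smul_mem ((u : ℂ) / f h) hh)
    rw [map_smul, smul_eq_mul, div_mul_cancel₀ _ hne] at this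
    simp at this
  have hu : 0 < u := by simpa using hfu 0 X.zero_mem
  have hne : f v ≠ 0 := by
    intro h
    rw [h, map_zero] at huf
    exact huf.not_gt hu
  refine ⟨(f v)⁻¹ • f, fun h hh => ?_, ?_⟩
  · rw [smul_apply, hzero h hh, smul_zero]
  · rw [smul_apply, smul_eq_mul, inv_mul_cancel₀ hne]

/-- A point outside a weak-star closed subspace of the dual is separated from it by the evaluation
at a vector. -/
theorem exists_eval_separating {E : Type*} [AddCommGroup E] [Module ℂ E] [TopologicalSpace E]
    {X : Submodule ℂ (WeakDual ℂ E)}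
    (hX : IsClosed (X : Set (WeakDual ℂ E))) {h₀ : WeakDual ℂ E} (h₀X : h₀ ∉ X) :
    ∃ x : E, (∀ h ∈ X, h x = 0) ∧ h₀ x = 1 := by
  have : IsTopologicalAddGroup (WeakDual ℂ E) := WeakBilin.instIsTopologicalAddGroup _
  let i : WeakDual ℂ E →ₗ[ℂ] E → ℂ := ⟨⟨fun h x => h x, fun _ _ => rfl⟩, fun _ _ => rfl⟩
  let : Module ℝ (WeakDual ℂ E) := Module.complexToReal _
  have : IsScalarTower ℝ ℂ (WeakDual ℂ E) := ⟨fun r c h => DFunLike.ext _ _ fun x =>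
    smul_assoc r c (h x)⟩
  have : LocallyConvexSpace ℝ (WeakDual ℂ E) := LocallyConvexSpace.induced (i.restrictScalars ℝ)
  obtain ⟨f, hf⟩ := exists_strongDual_eq_one_of_notMem hX h₀X
  -- Weak-star continuous functionals are exactly the evaluations.
  obtain ⟨x, rfl⟩ := LinearMap.dualEmbedding_surjective (topDualPairing ℂ E) f
  exact ⟨x, hf⟩

/-- An equicontinuous set of functionals is uniformly bounded on a neighbourhood of the origin. -/
theorem exists_nhds_bound_of_equicontinuousAt {ι E : Type*} [AddCommGroup E] [Module ℂ E]
    [TopologicalSpace E] {f : ι → E → ℂ} (hf : EquicontinuousAt f 0) (h0 : ∀ i, f i 0 = 0)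
    {ε : ℝ} (hε : 0 < ε) : ∃ U ∈ 𝓝 (0 : E), ∀ i, ∀ x ∈ U, ‖f i x‖ ≤ ε := by
  refine ⟨_, Metric.equicontinuousAt_iff_right.1 hf ε hε, fun i x hx => ?_⟩
  have := hx i
  rw [h0, dist_zero_left] at this
  exact this.le

/-! ### Surjectivity from `B`-completeness -/

/-- **Pták's theorem**: a continuous linear map with dense range on a `B`-complete space is
surjective if the functionals whose pullbacks are bounded on a given neighbourhood of the origin
are equicontinuous. -/
theorem BComplete.surjective {E G : Type*} [AddCommGroup E] [Module ℂ E] [TopologicalSpace E]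
    [AddCommGroup G] [Module ℂ G] [TopologicalSpace G] [IsTopologicalAddGroup G]
    [ContinuousSMul ℂ G] [SeparatingDual ℂ G] (hE : BComplete E) (T : E →L[ℂ] G)
    (hd : DenseRange T)
    (hT : ∀ U ∈ 𝓝 (0 : E), ∃ W ∈ 𝓝 (0 : G), ∀ g : StrongDual ℂ G,
      (∀ x ∈ U, ‖g (T x)‖ ≤ 1) → ∀ w ∈ W, ‖g w‖ ≤ 1) :
    Function.Surjective T := by
  intro y
  by_cases hy : y = 0
  · exact ⟨0, by rw [map_zero, hy]⟩
  let Tt : WeakDual ℂ G →ₗ[ℂ] WeakDual ℂ E :=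
    { toFun := fun g => StrongDual.toWeakDual ((WeakDual.toStrongDual g).comp T)
      map_add' := fun _ _ => rfl
      map_smul' := fun _ _ => rfl }
  have hTtc : Continuous Tt := WeakDual.continuous_of_continuous_eval fun x =>
    WeakDual.eval_continuous (T x)
  -- If the transpose of this hyperplane is weak-star closed, a vector of `E` that annihilates it
  -- is, after scaling, a preimage of `y`.
  let L : Submodule ℂ (WeakDual ℂ G) :=
    { carrier := {g | g y = 0}
      add_mem' := fun {a b} ha hb => by
        change a y + b y = 0
        rw [show a y = 0 from ha, show b y = 0 from hb, add_zero]
      zero_mem' := rfl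
      smul_mem' := fun c a ha => by
        change c • a y = 0
        rw [show a y = 0 from ha, smul_zero] }
  have hLc : IsClosed (L : Set (WeakDual ℂ G)) :=
    isClosed_eq (WeakDual.eval_continuous y) continuous_const
  have hX : IsClosed (L.map Tt : Set (WeakDual ℂ E)) := by
    rw [hE]
    intro A hA
    obtain ⟨U, hU, hUA⟩ := exists_nhds_bound_of_equicontinuousAt (hA 0)
      (fun f => map_zero (f : WeakDual ℂ E)) one_pos
    obtain ⟨W, hW, hWg⟩ := hT U hU
    -- Elements of `A` are bounded by 1 on `U`, so by `hT` their preimages under `Tt` lie in the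
    -- compact polar of `W`. Hence the trace on `A` is that of a compact image.
    have hc : IsClosed (Tt '' ({g : WeakDual ℂ G | ∀ w ∈ W, ‖g w‖ ≤ 1} ∩ L)) :=
      (((isCompact_weakDual_polar hW).inter_right hLc).image hTtc).isClosed
    convert hc.preimage (continuous_subtype_val (p := (· ∈ A))) using 1
    ext a
    constructor
    · rintro ⟨g, hg, hga⟩
      refine ⟨g, ⟨hWg (WeakDual.toStrongDual g) fun x hx => ?_, hg⟩, hga⟩
      have := hUA a x hx
      rwa [← show Tt g = (a : WeakDual ℂ E) from hga] at this
    · rintro ⟨g, ⟨-, hg⟩, hga⟩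
      exact ⟨g, hg, hga⟩
  obtain ⟨g₀, hg₀⟩ := SeparatingDual.exists_eq_one (R := ℂ) hy
  -- Dense range makes the transpose injective.
  have hg₀X : Tt (StrongDual.toWeakDual g₀) ∉ L.map Tt := by
    rintro ⟨g, hg, hgg⟩
    have : (g : G → ℂ) = g₀ := by
      refine hd.equalizer (map_continuous g) g₀.continuous ?_
      ext x
      exact DFunLike.congr_fun hgg x
    have h1 : g y = 1 := by rw [this, hg₀]
    rw [show g y = 0 from hg] at h1
    exact zero_ne_one h1
  obtain ⟨x, hx, hx1⟩ := exists_eval_separating hX hg₀X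
  refine ⟨x, (SeparatingDual.eq_iff_forall_dual_eq (R := ℂ)).2 fun g => ?_⟩
  -- Subtracting `g y • g₀` projects `g` into `L`, which forces `g (T x) = g y`.
  have := hx (Tt (StrongDual.toWeakDual (g - g y • g₀))) (Submodule.mem_map_of_mem (by
    change g y - g y * g₀ y = 0
    rw [hg₀, mul_one, sub_self]))
  change g (T x) - g y * g₀ (T x) = 0 at this
  rw [show g₀ (T x) = 1 from hx1, mul_one] at this
  exact sub_eq_zero.1 this

/-! ### Equicontinuity on countable powers -/

/-- If `(x'_n)` is Eidelheit, the linear combinations of the `x'_n` bounded on a given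
neighbourhood of the origin involve only finitely many of the `x'_n`. -/
theorem IsEidelheit.exists_forall_apply_single_eq_zero {E : Type*} [AddCommGroup E] [Module ℂ E]
    [TopologicalSpace E] [ContinuousSMul ℂ E] {x' : ℕ → StrongDual ℂ E} (hx' : IsEidelheit x')
    {U : Set E} (hU : U ∈ 𝓝 (0 : E)) :
    ∃ N : ℕ, ∀ φ : StrongDual ℂ (ℕ → ℂ), (∀ x ∈ U, ‖φ fun n => x' n x‖ ≤ 1) →
      ∀ n, N ≤ n → φ (Pi.single n 1) = 0 := by
  let K : Set (StrongDual ℂ (ℕ → ℂ)) := {φ | ∀ x ∈ U, ‖φ fun n => x' n x‖ ≤ 1}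
  -- `ℂ^ℕ` is barrelled, so pointwise bounds suffice: each `c` is the image of some `x`, and `U`
  -- absorbs `x`.
  have hK : UniformEquicontinuous (fun (φ : K) (c : ℕ → ℂ) => (φ : StrongDual ℂ (ℕ → ℂ)) c) := by
    refine PolynormableSpace.banach_steinhaus (𝕜₁ := ℂ) (𝕜₂ := ℂ)
      (𝓕 := fun φ : K => (φ : (ℕ → ℂ) →L[ℂ] ℂ)) fun c => ?_
    obtain ⟨x, hx⟩ := hx' c
    obtain ⟨a, ha, hax⟩ := exists_ne_zero_smul_mem hU x
    rw [NormedSpace.isVonNBounded_iff, isBounded_iff_forall_norm_le]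
    refine ⟨‖a‖⁻¹, ?_⟩
    rintro _ ⟨φ, rfl⟩
    have h1 := φ.2 _ hax
    have h2 : (fun n => x' n (a • x)) = a • c := by
      ext n
      rw [map_smul, hx]
      rfl
    rw [h2, map_smul, smul_eq_mul, norm_mul] at h1
    rwa [← one_div, le_div_iff₀ (norm_pos_iff.2 ha), mul_comm]
  obtain ⟨W, hW, hWK⟩ := exists_nhds_bound_of_equicontinuousAt (hK.equicontinuous 0)
    (fun φ => map_zero _) one_pos
  rw [nhds_pi, Filter.mem_pi] at hW
  obtain ⟨I, hI, t, ht, htW⟩ := hW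
  obtain ⟨N, hN⟩ := hI.bddAbove
  refine ⟨N + 1, fun φ hφ n hn => ?_⟩
  by_contra hne
  -- `W` does not constrain coordinate `n`, so it contains the multiple of the unit vector on which
  -- `φ` equals 2, exceeding the bound 1.
  have hmem : ((2 : ℂ) / φ (Pi.single n 1)) • (Pi.single n 1 : ℕ → ℂ) ∈ W := by
    refine htW fun i hi => ?_
    have : i ≠ n := by have := hN hi; omega
    rw [Pi.smul_apply, Pi.single_eq_of_ne this, smul_zero]
    exact mem_of_mem_nhds (ht i)
  have := hWK ⟨φ, hφ⟩ _ hmem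
  simp only [map_smul, smul_eq_mul] at this
  rw [div_mul_cancel₀ _ hne] at this
  norm_num at this

theorem tendsto_sum_range_single {F : Type*} [AddCommGroup F] [TopologicalSpace F] (w : ℕ → F) :
    Filter.Tendsto (fun M => ∑ n ∈ Finset.range M, (Pi.single n (w n) : ℕ → F)) Filter.atTop
      (𝓝 w) := by
  rw [tendsto_pi_nhds]
  intro k
  refine tendsto_const_nhds.congr' ?_
  filter_upwards [Filter.eventually_gt_atTop k] with M hM
  rw [Finset.sum_apply, Finset.sum_pi_single, if_pos (Finset.mem_range.2 hM)]

/-- A pointwise bounded set of functionals on a countable power of a barrelled space, supported on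
finitely many common coordinates, is equicontinuous. -/
theorem exists_nhds_bound_of_pi {F : Type*} [AddCommGroup F] [Module ℂ F] [UniformSpace F]
    [IsUniformAddGroup F] [ContinuousSMul ℂ F] [BarrelledSpace ℂ F]
    {K : Set (StrongDual ℂ (ℕ → F))} {N : ℕ}
    (h0 : ∀ g ∈ K, ∀ n, N ≤ n → ∀ y, g (Pi.single n y) = 0)
    (hb : ∀ n y, ∃ C : ℝ, ∀ g ∈ K, ‖g (Pi.single n y)‖ ≤ C) :
    ∃ W ∈ 𝓝 (0 : ℕ → F), ∀ g ∈ K, ∀ w ∈ W, ‖g w‖ ≤ 1 := by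
  -- The `N` relevant coordinates contribute at most `1 / (N + 1)` each; the `+ 1` covers `N = 0`.
  have hV : ∀ n : ℕ, ∃ V ∈ 𝓝 (0 : F), ∀ g : K, ∀ y ∈ V,
      ‖(g : StrongDual ℂ (ℕ → F)) (Pi.single n y)‖ ≤ 1 / (N + 1 : ℝ) := by
    intro n
    have h : UniformEquicontinuous
        (fun (g : K) (y : F) => (g : StrongDual ℂ (ℕ → F)) (Pi.single n y)) := by
      refine PolynormableSpace.banach_steinhaus (𝕜₁ := ℂ) (𝕜₂ := ℂ)
        (𝓕 := fun g : K => (g : (ℕ → F) →L[ℂ] ℂ).comp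
          (ContinuousLinearMap.single ℂ (fun _ : ℕ => F) n)) fun y => ?_
      rw [NormedSpace.isVonNBounded_iff, isBounded_iff_forall_norm_le]
      obtain ⟨C, hC⟩ := hb n y
      exact ⟨C, by rintro _ ⟨g, rfl⟩; exact hC g g.2⟩
    exact exists_nhds_bound_of_equicontinuousAt (h.equicontinuous 0) (fun g => by simp)
      (by positivity)
  choose V hV hVK using hV
  refine ⟨(Set.Iio N).pi V, ?_, fun g hg w hw => ?_⟩
  · exact set_pi_mem_nhds (Set.finite_Iio N) fun n _ => hV n
  have h1 : g w = ∑ n ∈ Finset.range N, g (Pi.single n (w n)) := by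
    refine tendsto_nhds_unique ((g.continuous.tendsto w).comp (tendsto_sum_range_single w)) ?_
    refine tendsto_const_nhds.congr' ?_
    filter_upwards [Filter.eventually_ge_atTop N] with M hM
    rw [Function.comp_apply, map_sum]
    refine Finset.sum_subset (Finset.range_mono hM) fun n _ hn => h0 g hg n ?_ _
    simpa using hn
  rw [h1]
  calc ‖∑ n ∈ Finset.range N, g (Pi.single n (w n))‖
      ≤ ∑ n ∈ Finset.range N, 1 / (N + 1 : ℝ) :=
        norm_sum_le_of_le _ fun n hn => hVK n ⟨g, hg⟩ _ (hw n (Finset.mem_range.1 hn))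
    _ ≤ 1 := by
      rw [Finset.sum_const, Finset.card_range, nsmul_eq_mul, mul_one_div]
      exact div_le_one_of_le₀ (by linarith) (by positivity)

/-! ### Passing to the associated sequence -/

/-- The elementary tensor `x ⊗ y` as an element of `E ⊗_t F`. -/
noncomputable def TopTensor.tmul (t : TensorTop) {E F : Type*} [AddCommGroup E] [Module ℂ E]
    [AddCommGroup F] [Module ℂ F] (x : E) (y : F) : TopTensor t E F :=
  (x ⊗ₜ[ℂ] y : E ⊗[ℂ] F)

theorem TopTensor.smul_tmul {t : TensorTop} {E F : Type*} [AddCommGroup E] [Module ℂ E]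
    [AddCommGroup F] [Module ℂ F] (c : ℂ) (x : E) (y : F) :
    TopTensor.tmul t (c • x) y = c • TopTensor.tmul t x y :=
  rfl

section

variable {t : TensorTop} {E F : Type*}
    [AddCommGroup E] [Module ℂ E] [TopologicalSpace E] [ContinuousSMul ℂ E]
    [AddCommGroup F] [Module ℂ F] [UniformSpace F] [IsUniformAddGroup F] [ContinuousSMul ℂ F]
    [LocallyConvexSpace ℝ F] [T2Space F] [CompleteSpace F]

theorem associatedSequence_tmul (x' : ℕ → StrongDual ℂ E) (n : ℕ) (x : E) (y : F) :
    associatedSequence t x' n (TopTensor.tmul t x y : TopTensor t E F) = x' n x • y := by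
  have := uniformContinuousConstSMul_of_continuousConstSMul ℂ F
  refine (ContinuousLinearMap.fromCompletion_apply_coe _ _).trans ?_
  exact tensorIdLin_tmul _ _ _

/-- The `F`-associated sequence of an Eidelheit sequence is Eidelheit as soon as every neighbourhood
of the origin in `E ⊗_t F` contains the tensors `x ⊗ y` for all `x` in some neighbourhood of the
origin of `E` and all `y` in some total set of `F`. -/
theorem IsEidelheit.associatedSequence [BarrelledSpace ℂ F]
    (hZ : BComplete (CompletedTensor t E F))
    (ht : ∀ U ∈ 𝓝 (0 : TopTensor t E F), ∃ V ∈ 𝓝 (0 : E), ∃ B : Set F, IsTotalSet B ∧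
      ∀ x ∈ V, ∀ y ∈ B, TopTensor.tmul t x y ∈ U)
    {x' : ℕ → StrongDual ℂ E} (hx' : IsEidelheit x') :
    IsEidelheit (associatedSequence (F := F) t x') := by
  let S : CompletedTensor t E F →L[ℂ] (ℕ → F) :=
    ContinuousLinearMap.pi (_root_.associatedSequence t x')
  have hS : ∀ x y, S (TopTensor.tmul t x y : TopTensor t E F) = fun n => x' n x • y := fun x y =>
    funext fun n => associatedSequence_tmul x' n x y
  suffices h : Function.Surjective S by
    intro y
    obtain ⟨z, hz⟩ := h y
    exact ⟨z, fun n => congrFun hz n⟩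
  have he : ∀ n : ℕ, ∃ e : E, ∀ m, x' m e = (Pi.single n 1 : ℕ → ℂ) m :=
    fun n => hx' (Pi.single n 1)
  choose e he using he
  have hSe : ∀ n y, S (TopTensor.tmul t (e n) y : TopTensor t E F) = Pi.single n y := by
    intro n y
    rw [hS]
    ext m
    rw [he]
    rcases eq_or_ne m n with rfl | hm
    · simp
    · simp [hm]
  have : SeparatingDual ℂ (ℕ → F) := ⟨fun w hw => by
    obtain ⟨n, hn⟩ := Function.ne_iff.1 hw
    obtain ⟨f, hf⟩ := RCLike.geometric_hahn_banach_point_point (𝕜 := ℂ) hn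
    refine ⟨f.comp (ContinuousLinearMap.proj n), fun h => ?_⟩
    rw [show f (w n) = 0 from h] at hf
    simp at hf⟩
  refine hZ.surjective S ?_ fun U hU => ?_
  · intro w
    refine mem_closure_of_tendsto (tendsto_sum_range_single w)
      (Filter.Eventually.of_forall fun M => ?_)
    refine ⟨∑ n ∈ Finset.range M, (TopTensor.tmul t (e n) (w n) : TopTensor t E F), ?_⟩
    rw [map_sum]
    exact Finset.sum_congr rfl fun n _ => hSe n (w n)
  have hU' : ((↑) : TopTensor t E F → CompletedTensor t E F) ⁻¹' U ∈ 𝓝 (0 : TopTensor t E F) :=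
    (UniformSpace.Completion.continuous_coe _).continuousAt.preimage_mem_nhds hU
  obtain ⟨V, hV, B, hB, hVB⟩ := ht _ hU'
  obtain ⟨N, hN⟩ := hx'.exists_forall_apply_single_eq_zero hV
  refine exists_nhds_bound_of_pi (K := {g | ∀ z ∈ U, ‖g (S z)‖ ≤ 1}) (N := N) ?_ ?_
  · intro g hg n hn
    have hcont : Continuous fun y => g (Pi.single n y) :=
      (g.comp (ContinuousLinearMap.single ℂ (fun _ : ℕ => F) n)).continuous
    have hspan : ∀ y ∈ Submodule.span ℂ B, g (Pi.single n y) = 0 := by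
      intro y hy
      induction hy using Submodule.span_induction with
      | mem y hy =>
        -- Restricting `g` to scalar multiples of `y` reduces to `ℂ^ℕ`; the index `N` was fixed
        -- before `g` and `y`.
        let φ : StrongDual ℂ (ℕ → ℂ) := g.comp (ContinuousLinearMap.pi fun n =>
          (ContinuousLinearMap.proj n : (ℕ → ℂ) →L[ℂ] ℂ).smulRight y)
        have hφ : ∀ c, φ c = g fun n => c n • y := fun _ => rfl
        have h1 := hN φ (fun x hx => by
          rw [hφ, ← hS]
          exact hg _ (hVB x hx y hy)) n hn
        rw [hφ] at h1
        rw [← h1]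
        congr 1
        ext m
        rcases eq_or_ne m n with rfl | hm
        · simp
        · simp [hm]
      | zero => simp
      | add a b _ _ ha hb => rw [Pi.single_add, map_add, ha, hb, add_zero]
      | smul c a _ ha => rw [Pi.single_smul, map_smul, ha, smul_zero]
    intro y
    exact congrFun (hcont.ext_on hB continuous_const hspan) y
  · intro n y
    -- The absorbing factor depends on `n` and `y` but not on `g`, giving the pointwise bound.
    obtain ⟨a, ha, hay⟩ := exists_ne_zero_smul_mem hU' (TopTensor.tmul t (e n) y)
    refine ⟨‖a‖⁻¹, fun g hg => ?_⟩
    rw [← TopTensor.smul_tmul] at hay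
    have h1 := hg _ hay
    have h2 : S (TopTensor.tmul t (a • e n) y : TopTensor t E F) = a • Pi.single n y := by
      rw [← hSe, hS, hS]
      ext m
      simp [mul_smul]
    rw [h2, map_smul, smul_eq_mul, norm_mul] at h1
    rwa [← one_div, le_div_iff₀ (norm_pos_iff.2 ha), mul_comm]

end

/-! ### Elementary tensors near zero in the three topologies -/

section

variable {E F : Type*} [AddCommGroup E] [Module ℂ E] [TopologicalSpace E]
    [AddCommGroup F] [Module ℂ F] [TopologicalSpace F]

/-- Neighbourhoods of zero are absorbing, hence span the whole space. This is why joint continuity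
needs no bounded total set. -/
theorem isTotalSet_of_mem_nhds [ContinuousSMul ℂ F] {V : Set F} (hV : V ∈ 𝓝 (0 : F)) :
    IsTotalSet V := by
  have : Submodule.span ℂ V = ⊤ := by
    refine eq_top_iff.2 fun y _ => ?_
    obtain ⟨c, hc, hcy⟩ := exists_ne_zero_smul_mem hV y
    exact (Submodule.smul_mem_iff _ hc).1 (Submodule.subset_span hcy)
  rw [IsTotalSet, this]
  exact dense_univ

theorem tendsto_tmul_epsilon :
    Filter.Tendsto (fun p : E × F => p.1 ⊗ₜ[ℂ] p.2) (𝓝 0)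
      (@nhds _ (epsilonTopology E F) (0 : E ⊗[ℂ] F)) := by
  rw [nhds_induced, Filter.tendsto_comap_iff, UniformOnFun.tendsto_iff_tendstoUniformlyOn]
  rintro S ⟨A, B, hA, hB, rfl⟩
  rw [Metric.tendstoUniformlyOn_iff]
  intro ε hε
  obtain ⟨U, hU, hUA⟩ := exists_nhds_bound_of_equicontinuousAt (hA 0)
    (fun f => map_zero (f : StrongDual ℂ E)) one_pos
  obtain ⟨V, hV, hVB⟩ := exists_nhds_bound_of_equicontinuousAt (hB 0)
    (fun f => map_zero (f : StrongDual ℂ F)) (half_pos hε)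
  rw [Prod.zero_eq_mk, nhds_prod_eq]
  filter_upwards [Filter.prod_mem_prod hU hV]
  rintro ⟨x, y⟩ ⟨hx, hy⟩ ⟨f, g⟩ ⟨hf, hg⟩
  have h : ‖f x * g y‖ ≤ 1 * (ε / 2) := by
    rw [norm_mul]
    exact mul_le_mul (hUA ⟨f, hf⟩ x hx) (hVB ⟨g, hg⟩ y hy) (norm_nonneg _) zero_le_one
  change dist (tensorToBilin E F 0 (f, g)) (tensorToBilin E F (x ⊗ₜ[ℂ] y) (f, g)) < ε
  simp only [tensorToBilin, map_zero, dist_zero_left, LinearMap.pi_apply,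
    TensorProduct.dualDistrib_apply]
  exact h.trans_lt (by linarith)

theorem tendsto_tmul_pi :
    Filter.Tendsto (fun p : E × F => p.1 ⊗ₜ[ℂ] p.2) (𝓝 0)
      (@nhds _ (piTopology E F) (0 : E ⊗[ℂ] F)) := by
  have h : @Continuous (E × F) (E ⊗[ℂ] F) _ (piTopology E F) fun p => p.1 ⊗ₜ[ℂ] p.2 :=
    continuous_sInf_rng.2 fun _ hτ => hτ.2.2.2
  simpa using @Continuous.tendsto _ _ _ (piTopology E F) _ h 0

/-- The principal filter encodes uniformity over `B`; only hypocontinuity with respect to bounded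
sets of the second factor enters. -/
theorem tendsto_tmul_beta {B : Set F} (hB : Bornology.IsVonNBounded ℂ B) :
    Filter.Tendsto (fun p : E × F => p.1 ⊗ₜ[ℂ] p.2) (𝓝 0 ×ˢ Filter.principal B)
      (@nhds _ (betaTopology E F) (0 : E ⊗[ℂ] F)) := by
  rw [nhds_sInf]
  simp only [Filter.tendsto_iInf]
  intro τ hτ W hW
  obtain ⟨U, hU, hUB⟩ := hτ.2.2.2.1 B hB W hW
  refine Filter.mem_map.2 (Filter.mem_of_superset
    (Filter.prod_mem_prod hU (Filter.mem_principal_self B)) ?_)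
  exact fun p hp => hUB p.1 hp.1 p.2 hp.2

end

theorem proposition4p1 {E F : Type*}
    [AddCommGroup E] [Module ℂ E] [TopologicalSpace E] [IsTopologicalAddGroup E]
    [ContinuousSMul ℂ E] [LocallyConvexSpace ℝ E] [T2Space E]
    [AddCommGroup F] [Module ℂ F] [UniformSpace F] [IsUniformAddGroup F]
    [ContinuousSMul ℂ F] [LocallyConvexSpace ℝ F] [T2Space F]
    [BarrelledSpace ℂ F] [CompleteSpace F]
    (hE : BComplete E) :
    (∀ t : TensorTop, t = .epsilon ∨ t = .pi →
      BComplete (CompletedTensor t E F) →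
      ∀ x' : ℕ → StrongDual ℂ E, IsEidelheit x' →
        IsEidelheit (associatedSequence (F := F) t x')) ∧
    ((∃ B : Set F, Bornology.IsVonNBounded ℂ B ∧ IsTotalSet B) →
      BComplete (CompletedTensor .beta E F) →
      ∀ x' : ℕ → StrongDual ℂ E, IsEidelheit x' →
        IsEidelheit (associatedSequence (F := F) .beta x')) := by
  refine ⟨fun t ht hZ x' hx' => hx'.associatedSequence hZ fun U hU => ?_,
    fun ⟨B, hB, hBt⟩ hZ x' hx' => hx'.associatedSequence hZ fun U hU => ?_⟩
  · have h : Filter.Tendsto (fun p : E × F => TopTensor.tmul t p.1 p.2) (𝓝 0) (𝓝 0) := by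
      rcases ht with rfl | rfl
      · exact tendsto_tmul_epsilon
      · exact tendsto_tmul_pi
    have hmem := h hU
    rw [Prod.zero_eq_mk, nhds_prod_eq, Filter.mem_map, Filter.mem_prod_iff] at hmem
    obtain ⟨V, hV, B, hB, hVB⟩ := hmem
    exact ⟨V, hV, B, isTotalSet_of_mem_nhds hB, fun x hx y hy => hVB (Set.mk_mem_prod hx hy)⟩
  · have hmem := tendsto_tmul_beta (E := E) hB hU
    have hmem := Filter.mem_prod_principal.1 (Filter.mem_map.1 hmem)
    exact ⟨_, hmem, B, hBt, fun x hx y hy => hx y hy⟩
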